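/- Let $T$ be a finite tree that is not a path, with distance function $d$. A vertex of degree at least $3$ is called *major*. A leaf $u$ is a *terminal vertex* of a major vertex $v$ if $d(u,v)<d(u,w)$ for every other major vertex $w$; $\operatorname{ter}(v)$ is the number of terminal vertices of $v$, and $\mathcal M(T)$ is the set of major vertices $v$ with $\operatorname{ter}(v)\ge 2$. For $w\in\mathcal M(T)$ let $l(w)$ be the minimum of $d(u,w)$ over the terminal vertices $u$ of $w$, let $\varsigma(w)$ be the minimum of $d(u,w)+d(w,u')$ over pairs of different terminal vertices $u,u'$ of $w$ (the length of the path from $u$ to $u'$ through $w$), and let $\varsigma(T)=\min_{w\in\mathcal M(T)}\varsigma(w)$. For an integer $k\ge 0$ put $$I_k(w)=\begin{cases}(\operatorname{ter}(w)-1)(k-l(w))+l(w), & l(w)\le\lfloor k/2\rfloor,\\ (\operatorname{ter}(w)-1)\lceil k/2\rceil+\lfloor k/2\rfloor, & \text{otherwise.}\end{cases}$$ A set $S\subseteq V(T)$ is a *$k$-metric generator* if for any two different vertices $x,y$ there are at least $k$ vertices $z\in S$ with $d(x,z)\ne d(y,z)$; $\dim_k(T)$ is the minimum cardinality of a $k$-metric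 generator. Root $T$ at a major vertex $v$. The algorithm visits the vertices in post-order (children before parents) and assigns to each vertex $u$ a pair $(a_u,b_u)$ as follows. * If $u$ has no child, $(a_u,b_u)=(1,\infty)$. * If $u$ has exactly one child $u'$, $(a_u,b_u)=(a_{u'}+1,b_{u'})$, where $\infty+1=\infty$. * If $u$ has at least two children, $a_u=\infty$. Let $a_{\min}$ be the minimum of the $a$-labels of the children, $c_u$ the number of children whose $a$-label is not $\infty$, and $s_u$ the sum of those $b$-labels of the children that are not $\infty$. Then $b_u=s_u$ if $c_u\le 1$; $b_u=a_{\min}+(c_u-1)(k-a_{\min})+s_u$ if $c_u\ge 2$ and $a_{\min}\le\lfloor k/2\rfloor$; and $b_u=\lfloor k/2\rfloor+(c_u-1)\lceil k/2\rceil+s_u$ if $c_u\ge2$ and $a_{\min}>\lfloor k/2\rfloor$. The output is the root label $b_v$. **Claim.** For every integer $k$ with $0\le k\le\varsigma(T)$, $T$ has a major vertex, and for every choice of a major vertex $v$ as the root, $$b_v=\dim_k(T)=\sum_{w\in\mathcal M(T)}I_k(w).$$ -/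

import Mathlib

namespace KMetric

/-! ### k-metric generators and the k-metric dimension -/

/-- `S` is a `k`-metric generator of `G`: any two different vertices are distinguished by at least
`k` elements of `S`. -/
def IsGenerator {V : Type*} (G : SimpleGraph V) (k : ℕ) (S : Finset V) : Prop :=
  ∀ x y : V, x ≠ y → k ≤ (S.filter fun z => G.dist x z ≠ G.dist y z).card

/-- The `k`-metric dimension: the minimum cardinality of a `k`-metric generator. Its value is `⊤`
exactly when there is no `k`-metric generator. -/
noncomputable def dim {V : Type*} (G : SimpleGraph V) (k : ℕ) : ℕ∞ :=
  ⨅ S ∈ {S : Finset V | IsGenerator G k S}, (S.card : ℕ∞)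

/-! ### Local and global parameters of a tree -/

/-- `G` is (isomorphic to) a path graph. -/
def IsPathGraph {V : Type*} [Fintype V] (G : SimpleGraph V) : Prop :=
  Nonempty (G ≃g SimpleGraph.pathGraph (Fintype.card V))

open Classical in
/-- A major vertex is a vertex of degree at least three. -/
def IsMajor {V : Type*} [Fintype V] (T : SimpleGraph V) (v : V) : Prop :=
  3 ≤ T.degree v

open Classical in
/-- The terminal vertices of a (major) vertex `v`: the leaves that are strictly closer to `v` than
to every other major vertex. -/
noncomputable def terminalVertices {V : Type*} [Fintype V] (T : SimpleGraph V) (v : V) : Finset V :=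
  Finset.univ.filter fun u => T.degree u = 1 ∧ ∀ w : V, IsMajor T w → w ≠ v → T.dist u v < T.dist u w

/-- The terminal degree of `v`. -/
noncomputable def ter {V : Type*} [Fintype V] (T : SimpleGraph V) (v : V) : ℕ :=
  (terminalVertices T v).card

/-- An exterior major vertex is a major vertex of positive terminal degree. -/
def IsExteriorMajor {V : Type*} [Fintype V] (T : SimpleGraph V) (v : V) : Prop :=
  IsMajor T v ∧ 0 < ter T v

open Classical in
/-- `M(T)`: the exterior major vertices of terminal degree greater than one. -/
noncomputable def extMajor {V : Type*} [Fintype V] (T : SimpleGraph V) : Finset V :=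
  Finset.univ.filter fun v => IsExteriorMajor T v ∧ 1 < ter T v

/-- `l(w)`: the least distance from `w` to a terminal vertex of `w`. -/
noncomputable def ell {V : Type*} [Fintype V] (T : SimpleGraph V) (w : V) : ℕ :=
  sInf {m : ℕ | ∃ u ∈ terminalVertices T w, m = T.dist u w}

/-- `ς(w)`: the least length of a path through `w` joining two different terminal vertices
of `w`. -/
noncomputable def varsigmaAt {V : Type*} [Fintype V] (T : SimpleGraph V) (w : V) : ℕ :=
  sInf {m : ℕ | ∃ u ∈ terminalVertices T w, ∃ u' ∈ terminalVertices T w,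
    u ≠ u' ∧ m = T.dist u w + T.dist w u'}

/-- `ς(T)`: the minimum of `ς(w)` over `w ∈ M(T)`. -/
noncomputable def varsigma {V : Type*} [Fintype V] (T : SimpleGraph V) : ℕ :=
  sInf {m : ℕ | ∃ w ∈ extMajor T, m = varsigmaAt T w}

/-- `I_k(w)`; here `k / 2` is the floor and `(k + 1) / 2` the ceiling of half of `k`. -/
noncomputable def I {V : Type*} [Fintype V] (T : SimpleGraph V) (k : ℕ) (w : V) : ℕ :=
  if ell T w ≤ k / 2 then (ter T w - 1) * (k - ell T w) + ell T w
  else (ter T w - 1) * ((k + 1) / 2) + k / 2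

/-! ### The labelling algorithm -/

open Classical in
/-- The children of `u` when `T` is rooted at `r`. -/
noncomputable def children {V : Type*} [Fintype V] (T : SimpleGraph V) (r u : V) : Finset V :=
  Finset.univ.filter fun c => T.Adj u c ∧ T.dist r c = T.dist r u + 1

/-- The pair `(a_u, b_u)` assigned to a vertex `u` on its visit, computed from the multiset `L` of
the pairs `(a_c, b_c)` already assigned to its children `c`. -/
noncomputable def step (k : ℕ) (L : Multiset (ℕ∞ × ℕ∞)) : ℕ∞ × ℕ∞ :=
  if L.card = 0 then
    -- no child
    (1, ⊤)
  else if L.card = 1 then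
    -- one child: both sums consist of the single label of that child
    ((L.map Prod.fst).sum + 1, (L.map Prod.snd).sum)
  else
    let aMin : ℕ∞ := (L.map Prod.fst).inf
    let c : ℕ := (L.filter fun p => p.1 ≠ ⊤).card
    let s : ℕ∞ := ((L.map Prod.snd).filter fun b => b ≠ ⊤).sum
    (⊤,
      if c ≤ 1 then s
      else if aMin ≤ ((k / 2 : ℕ) : ℕ∞) then
        aMin + ((c - 1 : ℕ) : ℕ∞) * ((k : ℕ∞) - aMin) + s
      else
        ((k / 2 : ℕ) : ℕ∞) + ((c - 1 : ℕ) : ℕ∞) * (((k + 1) / 2 : ℕ) : ℕ∞) + s)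

theorem children_decreasing {V : Type*} [Fintype V] (T : SimpleGraph V) (r u c : V)
    (hc : c ∈ children T r u) :
    Fintype.card V - T.dist r c < Fintype.card V - T.dist r u := by
  classical
  have h : T.Adj u c ∧ T.dist r c = T.dist r u + 1 := by simpa [children] using hc
  have hr : T.Reachable r c := by
    by_contra hn
    have := SimpleGraph.dist_eq_zero_of_not_reachable hn
    omega
  obtain ⟨p, hp, hlen⟩ := hr.exists_path_of_dist
  have := hp.length_lt
  omega

/-- The pair `(a_u, b_u)` that the algorithm assigns to `u` when `T` is rooted at `r`: all children
of `u` are processed first (post-order), then `u` is visited. -/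
noncomputable def label {V : Type*} [Fintype V] (T : SimpleGraph V) (r : V) (k : ℕ) (u : V) :
    ℕ∞ × ℕ∞ :=
  step k ((children T r u).attach.val.map fun c => label T r k c.1)
termination_by Fintype.card V - T.dist r u
decreasing_by exact children_decreasing T r u c.1 c.2

/-- The recursion of `label`. -/
theorem label_eq {V : Type*} [Fintype V] (T : SimpleGraph V) (r : V) (k : ℕ) (u : V) :
    label T r k u = step k ((children T r u).val.map (label T r k)) := by
  rw [label]
  congr 1
  exact Multiset.attach_map_val' _ _

/-- The output of the algorithm: the second component `b_r` of the label of the root `r`. -/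
noncomputable def output {V : Type*} [Fintype V] (T : SimpleGraph V) (r : V) (k : ℕ) : ℕ∞ :=
  (label T r k r).2

end KMetric

/-!
The proof works with the *branches* of the tree: for adjacent `m` and `n`, the branch at `m`
towards `n` is the component of `T - m` containing `n`, and it has the purely metric description
`{z | d(z, m) = d(z, n) + 1}`. A branch at `w` without major vertices is a *leg* of `w`. It is a
path, its only leaf is a terminal vertex of `w`, and its number of vertices is the distance from
that leaf to `w`; conversely every terminal vertex of a major vertex `w` arises in this way
(`exists_terminalVertices_eq_image`). So `ter`, `ell` and `varsigma` are statements about the number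
and the sizes of legs.

*Lower bound* (`sum_I_le_card`). The first vertices of two legs of `w` are told apart only by
vertices of these two legs, so any two legs of `w` together contain at least `k` elements of a
generator, and hence all legs of `w` together contain at least `I_k(w)` of them. Legs of different
major vertices are disjoint.

*Upper bound* (`exists_isGenerator_card_le`). Because `k ≤ ς(T)`, one can choose `I_k(w)` vertices
on the legs of each `w ∈ M(T)` such that any two legs of `w` together contain `k` of them. All these
vertices form a generator, since any `x ≠ y` are told apart by all vertices of two legs of some `w`
(`exists_two_legs_distinguish`): if `d(x, y)` is odd, every vertex tells them apart; if it is even,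
the two branches at the midpoint that contain `x` and `y` do. Either one of these branches contains
a major vertex, and then it contains two legs of some `w` (`exists_extMajor_two_legs`), or both are
legs of the midpoint.

*The algorithm* (`label_eq_branchLabel`). Induction on the size of a branch shows that a vertex `u`
with parent `p` gets the label `(size, ∞)` if the branch at `p` towards `u` has no major vertex, and
`(∞, ∑ I_k(w))` otherwise, with the sum over the `w ∈ M(T)` in this branch. As the root is major, the
parent of a major vertex never lies on one of its legs.
-/

namespace KMetric

section Tree

open Classical

variable {V : Type*} {T : SimpleGraph V}

/-! ### Distances in a tree -/

theorem dist_add_dist_parity (hT : T.IsTree) (x y z : V) :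
    (T.dist z x + T.dist z y) % 2 = T.dist x y % 2 := by
  have key : ∀ {u v : V} (_ : T.Walk u v),
      (T.dist z u + T.dist x u) % 2 = (T.dist z v + T.dist x v) % 2 := by
    intro u v p
    induction p with
    | nil => rfl
    | cons h p ih =>
      have h1 := hT.dist_eq_dist_add_one_of_adj z h
      have h2 := hT.dist_eq_dist_add_one_of_adj x h
      omega
  obtain ⟨p⟩ := hT.connected x y
  have := key p
  rw [T.dist_self] at this
  omega

theorem exists_midpoint (hT : T.IsTree) {x y : V} {j : ℕ} (h : T.dist x y = 2 * j) :
    ∃ m, T.dist x m = j ∧ T.dist y m = j := by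
  obtain ⟨p, hp⟩ := hT.connected.exists_walk_length_eq_dist x y
  refine ⟨p.getVert j, ?_⟩
  have h1 := SimpleGraph.dist_le (p.take j)
  have h2 := SimpleGraph.dist_le (p.drop j)
  have h3 := hT.connected.dist_triangle (u := x) (v := p.getVert j) (w := y)
  rw [SimpleGraph.Walk.take_length] at h1
  rw [SimpleGraph.Walk.drop_length] at h2
  rw [T.dist_comm (u := y)]
  omega

variable [Fintype V]

/-! ### Branches of a tree -/

/-- The branch of `T` at `m` towards `n`: the vertices that are closer to `n` than to `m` by one.
For adjacent vertices `m`, `n` of a tree this is the component of `T - m` that contains `n`. -/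
noncomputable def branch (T : SimpleGraph V) (m n : V) : Finset V :=
  Finset.univ.filter fun z => T.dist z m = T.dist z n + 1

theorem mem_branch {m n z : V} : z ∈ branch T m n ↔ T.dist z m = T.dist z n + 1 := by
  simp [branch]

theorem self_mem_branch {m n : V} (h : T.Adj m n) : n ∈ branch T m n := by
  simp [mem_branch, SimpleGraph.dist_eq_one_iff_adj.2 h.symm]

theorem notMem_branch_self {m n : V} : m ∉ branch T m n := by
  simp [mem_branch]

theorem notMem_branch_swap {m n z : V} (h : z ∈ branch T m n) : z ∉ branch T n m := by
  rw [mem_branch] at *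
  omega

theorem mem_branch_or (hT : T.IsTree) {m n : V} (h : T.Adj m n) (z : V) :
    z ∈ branch T m n ∨ z ∈ branch T n m := by
  simpa [mem_branch] using hT.dist_eq_dist_add_one_of_adj z h

theorem exists_mem_branch (hT : T.IsTree) {m z : V} (h : z ≠ m) :
    ∃ n, T.Adj m n ∧ z ∈ branch T m n := by
  obtain ⟨p, hp⟩ := hT.connected.exists_walk_length_eq_dist m z
  cases p with
  | nil => exact absurd rfl h
  | @cons _ n _ hadj q =>
    refine ⟨n, hadj, (mem_branch_or hT hadj z).resolve_right fun hz => ?_⟩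
    have := SimpleGraph.dist_le q
    rw [mem_branch, T.dist_comm, T.dist_comm (v := m)] at hz
    simp only [SimpleGraph.Walk.length_cons] at hp
    omega

/-- Two different branches at a vertex of a tree are disjoint: a vertex in both would be joined to
`m` by two different geodesics. -/
theorem eq_of_mem_branch (hT : T.IsTree) {m n n' z : V} (h : T.Adj m n) (h' : T.Adj m n')
    (hz : z ∈ branch T m n) (hz' : z ∈ branch T m n') : n = n' := by
  rw [mem_branch, T.dist_comm, T.dist_comm (u := z)] at hz hz'
  obtain ⟨p, hp⟩ := hT.connected.exists_walk_length_eq_dist n z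
  obtain ⟨q, hq⟩ := hT.connected.exists_walk_length_eq_dist n' z
  have hp' := (p.cons h).isPath_of_length_eq_dist (by simp [hp, hz])
  have hq' := (q.cons h').isPath_of_length_eq_dist (by simp [hq, hz'])
  have := congrArg SimpleGraph.Walk.snd ((hT.existsUnique_path m z).unique hp' hq')
  simpa using this

/-- A geodesic from inside a branch at `m` to outside of it passes through `m`. -/
theorem dist_eq_of_mem_of_notMem_branch (hT : T.IsTree) {m n z y : V} (h : T.Adj m n)
    (hz : z ∈ branch T m n) (hy : y ∉ branch T m n) :
    T.dist z y = T.dist z m + T.dist m y := by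
  induction hd : T.dist m y using Nat.strong_induction_on generalizing y with
  | _ d ih =>
  by_cases hym : y = m
  · subst hym; simp_all
  -- `y'` is the next vertex on the way from `y` to `m`
  obtain ⟨y', hyy', hmy'⟩ := exists_mem_branch hT (Ne.symm hym)
  -- a step towards `m` does not enter the branch
  have key : ∀ {a b : V}, T.Adj a b → a ∉ branch T m n → m ∈ branch T a b →
      b ∉ branch T m n := by
    intro a b hab ha hm hb
    rcases mem_branch_or hT h a with h1 | h1
    · exact ha h1
    have h2 := SimpleGraph.Adj.diff_dist_adj (u := n) hab
    rw [mem_branch] at *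
    simp only [T.dist_comm (v := a), T.dist_comm (v := b)] at *
    omega
  have hy' := key hyy' hy hmy'
  have e := mem_branch.1 hmy'
  have ih' := ih (T.dist m y') (by omega) hy' rfl
  rcases mem_branch_or hT hyy' z with h1 | h1
  · rw [mem_branch] at h1
    omega
  exfalso
  by_cases hmy : y' = m
  · subst hmy
    have hyn := eq_of_mem_branch hT hyy'.symm h h1 hz
    exact hy (by rw [hyn]; exact self_mem_branch h)
  -- if `y'` were farther from `z` than `y`, then `y` and the next vertex `y''` on the way to `m` would
  -- be two neighbors of `y'` that are closer to `z`
  obtain ⟨y'', hyy'', hmy''⟩ := exists_mem_branch hT (Ne.symm hmy)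
  have e' := mem_branch.1 hmy''
  have ih'' := ih (T.dist m y'') (by omega) (key hyy'' hy' hmy'') rfl
  have : y = y'' := eq_of_mem_branch hT hyy'.symm hyy'' h1 (mem_branch.2 (by omega))
  subst this
  omega

theorem mem_branch_iff (hT : T.IsTree) {m n z : V} (h : T.Adj m n) :
    z ∈ branch T m n ↔ z = n ∨ ∃ c, T.Adj n c ∧ c ≠ m ∧ z ∈ branch T n c := by
  constructor
  · intro hz
    by_cases hzn : z = n
    · exact Or.inl hzn
    obtain ⟨c, hc, hzc⟩ := exists_mem_branch hT hzn
    refine Or.inr ⟨c, hc, ?_, hzc⟩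
    rintro rfl
    exact notMem_branch_swap hz hzc
  · rintro (rfl | ⟨c, hc, hcm, hz⟩)
    · exact self_mem_branch h
    · exact (mem_branch_or hT h z).resolve_right fun hz' =>
        hcm (eq_of_mem_branch hT hc h.symm hz hz')

theorem branch_eq_insert_biUnion (hT : T.IsTree) {m n : V} (h : T.Adj m n) :
    branch T m n = insert n (((T.neighborFinset n).erase m).biUnion (branch T n)) := by
  ext z
  rw [mem_branch_iff hT h]
  simp only [Finset.mem_insert, Finset.mem_biUnion, Finset.mem_erase,
    SimpleGraph.mem_neighborFinset]
  grind

theorem branch_subset_branch (hT : T.IsTree) {m n c : V} (h : T.Adj m n) (hc : T.Adj n c)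
    (hcm : c ≠ m) : branch T n c ⊆ branch T m n := fun _ hz =>
  (mem_branch_iff hT h).2 (Or.inr ⟨c, hc, hcm, hz⟩)

theorem card_branch_lt (hT : T.IsTree) {m n c : V} (h : T.Adj m n) (hc : T.Adj n c)
    (hcm : c ≠ m) : (branch T n c).card < (branch T m n).card :=
  Finset.card_lt_card (Finset.ssubset_iff_of_subset (branch_subset_branch hT h hc hcm) |>.2
    ⟨n, self_mem_branch h, notMem_branch_self⟩)

theorem pairwiseDisjoint_branch (hT : T.IsTree) (m : V) :
    (↑(T.neighborFinset m) : Set V).PairwiseDisjoint (branch T m) := by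
  intro n hn n' hn' hne
  refine Finset.disjoint_left.2 fun z hz hz' => hne ?_
  exact eq_of_mem_branch hT (by simpa using hn) (by simpa using hn') hz hz'

/-- Two branches at different vertices, neither of which contains the other vertex, are
disjoint. -/
theorem disjoint_branch_of_notMem (hT : T.IsTree) {w w' n n' : V} (hne : w ≠ w')
    (h : T.Adj w n) (h' : T.Adj w' n') (hw : w' ∉ branch T w n) (hw' : w ∉ branch T w' n') :
    Disjoint (branch T w n) (branch T w' n') := by
  refine Finset.disjoint_left.2 fun z hz hz' => ?_
  have e := dist_eq_of_mem_of_notMem_branch hT h hz hw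
  have e' := dist_eq_of_mem_of_notMem_branch hT h' hz' hw'
  have := hT.connected.pos_dist_of_ne hne
  rw [T.dist_comm (u := w')] at e'
  omega

/-! ### Legs and terminal vertices -/

/-- The legs of `w`, each given by the neighbor of `w` that it starts with: the branches at `w`
without major vertices. -/
noncomputable def legs (T : SimpleGraph V) (w : V) : Finset V :=
  (T.neighborFinset w).filter fun n => ∀ z ∈ branch T w n, ¬ IsMajor T z

theorem mem_legs {w n : V} :
    n ∈ legs T w ↔ T.Adj w n ∧ ∀ z ∈ branch T w n, ¬ IsMajor T z := by
  simp [legs]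

/-- A branch that starts with a vertex `n` of degree at most two is either `n` alone or `n` followed
by a single branch at `n`. -/
theorem branch_of_not_isMajor (hT : T.IsTree) {m n : V} (h : T.Adj m n) (hn : ¬ IsMajor T n) :
    (T.degree n = 1 ∧ branch T m n = {n}) ∨
      ∃ c, T.Adj n c ∧ c ≠ m ∧ T.degree n = 2 ∧ (T.neighborFinset n).erase m = {c} ∧
        branch T m n = insert n (branch T n c) := by
  have hm : m ∈ T.neighborFinset n := by simpa using h.symm
  have hcard := Finset.card_erase_add_one hm
  rw [SimpleGraph.card_neighborFinset_eq_degree] at hcard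
  have hb := branch_eq_insert_biUnion hT h
  unfold IsMajor at hn
  rcases Nat.eq_zero_or_pos ((T.neighborFinset n).erase m).card with h0 | h0
  · left
    rw [Finset.card_eq_zero.1 h0] at hb
    exact ⟨by omega, by simpa using hb⟩
  · right
    obtain ⟨c, hc⟩ := Finset.card_eq_one.1 (show ((T.neighborFinset n).erase m).card = 1 by omega)
    have hmem : c ∈ (T.neighborFinset n).erase m := by simp [hc]
    rw [Finset.mem_erase, SimpleGraph.mem_neighborFinset] at hmem
    rw [hc] at hb hcard
    exact ⟨c, hmem.2, hmem.1, by simpa using hcard.symm, hc, by simpa using hb⟩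

/-- A branch without major vertices is a path: it has exactly one leaf, which is its last
vertex. -/
theorem existsUnique_leaf (hT : T.IsTree) {m n : V} (h : T.Adj m n)
    (hfree : ∀ z ∈ branch T m n, ¬ IsMajor T z) :
    ∃ u ∈ branch T m n, T.degree u = 1 ∧ T.dist u m = (branch T m n).card ∧
      ∀ u' ∈ branch T m n, T.degree u' = 1 → u' = u := by
  induction hd : (branch T m n).card using Nat.strong_induction_on generalizing m n with
  | _ d ih =>
  rcases branch_of_not_isMajor hT h (hfree n (self_mem_branch h)) with
    ⟨h1, hb⟩ | ⟨c, hc, hcm, h2, -, hb⟩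
  · rw [hb] at hd ⊢
    refine ⟨n, by simp, h1, ?_, by simp⟩
    rw [SimpleGraph.dist_eq_one_iff_adj.2 h.symm, ← hd, Finset.card_singleton]
  · have hlt := card_branch_lt hT h hc hcm
    have hsub := branch_subset_branch hT h hc hcm
    obtain ⟨u, hu, hu1, hud, huu⟩ := ih _ (hd ▸ hlt) hc (fun z hz => hfree z (hsub hz)) rfl
    refine ⟨u, hsub hu, hu1, ?_, ?_⟩
    · rw [← hd, hb, Finset.card_insert_of_notMem notMem_branch_self, ← hud]
      exact mem_branch.1 (hsub hu)
    · intro u' hu' hu'1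
      rw [hb, Finset.mem_insert] at hu'
      rcases hu' with rfl | hu'
      · omega
      · exact huu u' hu' hu'1

/-- If a leaf `u` lies in a branch at `m`, and no major vertex of the branch is closer to `u` than
`m`, then the branch is a path. -/
theorem forall_not_isMajor_of_leaf (hT : T.IsTree) {m n u : V} (h : T.Adj m n)
    (hu : u ∈ branch T m n) (hu1 : T.degree u = 1)
    (hfar : ∀ z ∈ branch T m n, IsMajor T z → T.dist u m ≤ T.dist u z) :
    ∀ z ∈ branch T m n, ¬ IsMajor T z := by
  induction hd : (branch T m n).card using Nat.strong_induction_on generalizing m n with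
  | _ d ih =>
  have hun := mem_branch.1 hu
  have hn : ¬ IsMajor T n := fun hn => by
    have := hfar n (self_mem_branch h) hn
    omega
  rcases branch_of_not_isMajor hT h hn with ⟨h1, hb⟩ | ⟨c, hc, hcm, h2, -, hb⟩
  · rw [hb]
    simpa using hn
  · have hlt := card_branch_lt hT h hc hcm
    have hsub := branch_subset_branch hT h hc hcm
    have huc : u ∈ branch T n c := by
      rw [hb, Finset.mem_insert] at hu
      rcases hu with rfl | hu
      · omega
      · exact hu
    have := ih _ (hd ▸ hlt) hc huc
      (fun z hz hz' => by have := hfar z (hsub hz) hz'; omega) rfl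
    intro z hz
    rw [hb, Finset.mem_insert] at hz
    rcases hz with rfl | hz
    · exact hn
    · exact this z hz

theorem mem_terminalVertices_iff (hT : T.IsTree) {w u : V} (hw : IsMajor T w) :
    u ∈ terminalVertices T w ↔ ∃ n ∈ legs T w, u ∈ branch T w n ∧ T.degree u = 1 := by
  simp only [terminalVertices, Finset.mem_filter, Finset.mem_univ, true_and]
  constructor
  · rintro ⟨hu1, hu⟩
    have huw : u ≠ w := by
      rintro rfl
      unfold IsMajor at hw
      omega
    obtain ⟨n, hn, hun⟩ := exists_mem_branch hT huw
    refine ⟨n, mem_legs.2 ⟨hn, forall_not_isMajor_of_leaf hT hn hun hu1 fun z hz hz' => ?_⟩,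
      hun, hu1⟩
    refine (hu z hz' ?_).le
    rintro rfl
    exact notMem_branch_self hz
  · rintro ⟨n, hn, hun, hu1⟩
    refine ⟨hu1, fun w' hw' hne => ?_⟩
    rw [mem_legs] at hn
    rw [dist_eq_of_mem_of_notMem_branch hT hn.1 hun fun h => hn.2 _ h hw']
    have := hT.connected.pos_dist_of_ne hne.symm
    omega

/-- Each leg of a major vertex `w` ends in one terminal vertex of `w`, at distance the number of
vertices of the leg. -/
theorem exists_terminalVertices_eq_image (hT : T.IsTree) {w : V} (hw : IsMajor T w) :
    ∃ f : V → V, terminalVertices T w = (legs T w).image f ∧ Set.InjOn f (legs T w) ∧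
      ∀ n ∈ legs T w, T.dist (f n) w = (branch T w n).card := by
  have hex : ∀ n, ∃ u, n ∈ legs T w → u ∈ branch T w n ∧ T.degree u = 1 ∧
      T.dist u w = (branch T w n).card ∧ ∀ u' ∈ branch T w n, T.degree u' = 1 → u' = u := by
    intro n
    by_cases hn : n ∈ legs T w
    · obtain ⟨u, hu⟩ := existsUnique_leaf hT (mem_legs.1 hn).1 (mem_legs.1 hn).2
      exact ⟨u, fun _ => hu⟩
    · exact ⟨n, fun h => absurd h hn⟩
  choose f hf using hex
  refine ⟨f, ?_, ?_, fun n hn => (hf n hn).2.2.1⟩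
  · ext u
    rw [mem_terminalVertices_iff hT hw, Finset.mem_image]
    constructor
    · rintro ⟨n, hn, hun, hu1⟩
      exact ⟨n, hn, ((hf n hn).2.2.2 u hun hu1).symm⟩
    · rintro ⟨n, hn, rfl⟩
      exact ⟨n, hn, (hf n hn).1, (hf n hn).2.1⟩
  · intro n hn n' hn' he
    refine eq_of_mem_branch hT (mem_legs.1 hn).1 (mem_legs.1 hn').1 (hf n hn).1 ?_
    rw [he]
    exact (hf n' hn').1

theorem ter_eq_card_legs (hT : T.IsTree) {w : V} (hw : IsMajor T w) :
    ter T w = (legs T w).card := by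
  obtain ⟨f, hf, hinj, -⟩ := exists_terminalVertices_eq_image hT hw
  rw [ter, hf, Finset.card_image_of_injOn hinj]

theorem mem_extMajor_iff (hT : T.IsTree) {w : V} :
    w ∈ extMajor T ↔ IsMajor T w ∧ 2 ≤ (legs T w).card := by
  rw [extMajor, Finset.mem_filter]
  constructor
  · rintro ⟨-, ⟨hw, -⟩, h⟩
    exact ⟨hw, by rw [← ter_eq_card_legs hT hw]; omega⟩
  · rintro ⟨hw, h⟩
    rw [← ter_eq_card_legs hT hw] at h
    exact ⟨Finset.mem_univ _, ⟨hw, by omega⟩, by omega⟩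

theorem ell_eq_card_branch (hT : T.IsTree) {w : V} (hw : IsMajor T w)
    (hne : (legs T w).Nonempty) :
    (∃ n ∈ legs T w, ell T w = (branch T w n).card) ∧
      ∀ n ∈ legs T w, ell T w ≤ (branch T w n).card := by
  obtain ⟨f, hf, -, hd⟩ := exists_terminalVertices_eq_image hT hw
  have hset : {m : ℕ | ∃ u ∈ terminalVertices T w, m = T.dist u w} =
      {m : ℕ | ∃ n ∈ legs T w, m = (branch T w n).card} := by
    ext m
    simp only [hf, Finset.mem_image, exists_exists_and_eq_and, Set.mem_ofPred_eq]
    exact exists_congr fun n => and_congr_right fun hn => by rw [hd n hn]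
  rw [ell, hset]
  refine ⟨?_, fun n hn => Nat.sInf_le ⟨n, hn, rfl⟩⟩
  obtain ⟨n, hn⟩ := hne
  exact Nat.sInf_mem (s := {m : ℕ | ∃ n ∈ legs T w, m = (branch T w n).card}) ⟨_, n, hn, rfl⟩

theorem varsigma_le_card_add_card (hT : T.IsTree) {w n n' : V} (hw : w ∈ extMajor T)
    (hn : n ∈ legs T w) (hn' : n' ∈ legs T w) (hne : n ≠ n') :
    varsigma T ≤ (branch T w n).card + (branch T w n').card := by
  obtain ⟨f, hf, hinj, hd⟩ := exists_terminalVertices_eq_image hT ((mem_extMajor_iff hT).1 hw).1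
  have h1 : varsigma T ≤ varsigmaAt T w := Nat.sInf_le ⟨w, hw, rfl⟩
  refine h1.trans (Nat.sInf_le ⟨f n, ?_, f n', ?_, ?_, ?_⟩)
  · exact hf ▸ Finset.mem_image_of_mem f hn
  · exact hf ▸ Finset.mem_image_of_mem f hn'
  · exact fun h => hne (hinj hn hn' h)
  · rw [hd n hn, T.dist_comm, hd n' hn']

/-- A branch that contains a major vertex contains two legs of some member of `M(T)`: those of a
major vertex of the branch beyond which, seen from `m`, there are no further major vertices. -/
theorem exists_extMajor_two_legs (hT : T.IsTree) {m n z : V} (h : T.Adj m n)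
    (hz : z ∈ branch T m n) (hzM : IsMajor T z) :
    ∃ w ∈ extMajor T, ∃ c ∈ legs T w, ∃ c' ∈ legs T w, c ≠ c' ∧
      branch T w c ∪ branch T w c' ⊆ branch T m n := by
  induction hd : (branch T m n).card using Nat.strong_induction_on generalizing m n z with
  | _ d ih =>
  by_cases hex : ∃ c, T.Adj n c ∧ c ≠ m ∧ ∃ z ∈ branch T n c, IsMajor T z
  · obtain ⟨c, hc, hcm, z', hz', hz'M⟩ := hex
    obtain ⟨w, hw, a, ha, b, hb, hab, hsub⟩ :=
      ih _ (hd ▸ card_branch_lt hT h hc hcm) hc hz' hz'M rfl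
    exact ⟨w, hw, a, ha, b, hb, hab, hsub.trans (branch_subset_branch hT h hc hcm)⟩
  · push Not at hex
    have hn : IsMajor T n := by
      rcases (mem_branch_iff hT h).1 hz with rfl | ⟨c, hc, hcm, hzc⟩
      · exact hzM
      · exact absurd hzM (hex c hc hcm z hzc)
    have hsub : (T.neighborFinset n).erase m ⊆ legs T n := fun c hc => by
      rw [Finset.mem_erase, SimpleGraph.mem_neighborFinset] at hc
      exact mem_legs.2 ⟨hc.2, hex c hc.2 hc.1⟩
    have hcard : 1 < ((T.neighborFinset n).erase m).card := by
      have hm : m ∈ T.neighborFinset n := by simpa using h.symm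
      have := Finset.card_erase_add_one hm
      rw [SimpleGraph.card_neighborFinset_eq_degree] at this
      unfold IsMajor at hn
      omega
    obtain ⟨c, hc, c', hc', hne⟩ := Finset.one_lt_card.1 hcard
    refine ⟨n, (mem_extMajor_iff hT).2 ⟨hn, hcard.trans_le (Finset.card_le_card hsub)⟩,
      c, hsub hc, c', hsub hc', hne, ?_⟩
    rw [Finset.mem_erase, SimpleGraph.mem_neighborFinset] at hc hc'
    exact Finset.union_subset (branch_subset_branch hT h hc.2 hc.1)
      (branch_subset_branch hT h hc'.2 hc'.1)

/-! ### Trees without major vertices -/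

/-- In a tree of maximum degree at most two, vertices are determined by their distance to an end. -/
theorem injective_dist_of_forall_not_isMajor (hT : T.IsTree) (hno : ∀ v, ¬ IsMajor T v) {x : V}
    (hx : T.degree x ≤ 1) : Function.Injective (T.dist x) := by
  intro z z' he
  induction hd : T.dist x z generalizing z z' with
  | zero =>
    rw [hd] at he
    exact (hT.connected.dist_eq_zero_iff.1 hd).symm.trans (hT.connected.dist_eq_zero_iff.1 he.symm)
  | succ d ih =>
    have hpos : ∀ {a}, T.dist x a = d + 1 → x ≠ a := by
      rintro a ha rfl
      simp at ha
    obtain ⟨p, hp, hxp⟩ := exists_mem_branch hT (hpos hd)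
    obtain ⟨p', hp', hxp'⟩ := exists_mem_branch hT (hpos (he ▸ hd))
    rw [mem_branch] at hxp hxp'
    have hpp : p = p' := ih (by omega) (by omega)
    subst hpp
    by_contra hne
    by_cases hpx : x = p
    · subst hpx
      have : ({z, z'} : Finset V) ⊆ T.neighborFinset x := by
        simp [Finset.insert_subset_iff, hp.symm, hp'.symm]
      have := Finset.card_le_card this
      rw [Finset.card_pair hne, SimpleGraph.card_neighborFinset_eq_degree] at this
      omega
    · obtain ⟨q, hq, hxq⟩ := exists_mem_branch hT hpx
      rw [mem_branch] at hxq
      have : ({q, z, z'} : Finset V) ⊆ T.neighborFinset p := by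
        simp [Finset.insert_subset_iff, hp.symm, hp'.symm, hq]
      have := Finset.card_le_card this
      rw [Finset.card_eq_three.2 ⟨q, z, z', by rintro rfl; omega, by rintro rfl; omega, hne, rfl⟩,
        SimpleGraph.card_neighborFinset_eq_degree] at this
      exact hno p this

theorem isPathGraph_of_forall_not_isMajor (hT : T.IsTree) (hno : ∀ v, ¬ IsMajor T v) :
    IsPathGraph T := by
  obtain ⟨x, hx⟩ : ∃ x, T.degree x ≤ 1 := by
    rcases subsingleton_or_nontrivial V with hV | hV
    · obtain ⟨x⟩ := hT.connected.nonempty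
      refine ⟨x, ?_⟩
      rw [← SimpleGraph.card_neighborFinset_eq_degree]
      exact (Finset.card_le_univ _).trans (Fintype.card_le_one_iff_subsingleton.2 hV)
    · obtain ⟨x, hx⟩ := hT.exists_vert_degree_one_of_nontrivial
      exact ⟨x, hx.le⟩
  have hinj := injective_dist_of_forall_not_isMajor hT hno hx
  have hlt : ∀ z, T.dist x z < Fintype.card V := fun z => by
    obtain ⟨p, hp, hlen⟩ := hT.connected.exists_path_of_dist x z
    exact hlen ▸ hp.length_lt
  let f : V → Fin (Fintype.card V) := fun z => ⟨T.dist x z, hlt z⟩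
  have hf : Function.Bijective f := (Fintype.bijective_iff_injective_and_card f).2
    ⟨fun a b h => hinj (by simpa [f] using h), by simp⟩
  have hadj : ∀ {a b}, T.dist x a + 1 = T.dist x b → T.Adj a b := by
    intro a b h
    have hxb : x ≠ b := by
      rintro rfl
      simp at h
    obtain ⟨p, hp, hxp⟩ := exists_mem_branch hT hxb
    rw [mem_branch] at hxp
    exact hinj (show T.dist x a = T.dist x p by omega) ▸ hp.symm
  refine ⟨⟨Equiv.ofBijective f hf, ?_⟩⟩
  intro a b
  rw [SimpleGraph.pathGraph_adj]
  simp only [Equiv.ofBijective_apply, f]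
  constructor
  · rintro (h | h)
    · exact hadj h
    · exact (hadj h).symm
  · intro h
    have := hT.dist_eq_dist_add_one_of_adj x h
    omega

/-! ### The k-metric dimension -/

/-- The two cases in the definition of `I` are one formula, in terms of `min l(w) ⌊k/2⌋`. -/
theorem I_eq (k : ℕ) (w : V) : I T k w =
    (ter T w - 1) * (k - min (ell T w) (k / 2)) + min (ell T w) (k / 2) := by
  unfold I
  split_ifs with h
  · rw [min_eq_left h]
  · rw [min_eq_right (by omega), show k - k / 2 = (k + 1) / 2 by omega]

/-- If any two of the numbers `s i` add up to at least `k` and one of them is at most `l`, then their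
sum is at least that of the choice `min l ⌊k/2⌋` for one of them and `k - min l ⌊k/2⌋` for the
others. -/
theorem le_sum_of_pairwise {ι : Type*} {L : Finset ι} {s : ι → ℕ} {k l : ℕ} (hL : 2 ≤ L.card)
    (hl : ∃ i ∈ L, s i ≤ l)
    (hs : ∀ i ∈ L, ∀ j ∈ L, i ≠ j → k ≤ s i + s j) :
    (L.card - 1) * (k - min l (k / 2)) + min l (k / 2) ≤ ∑ i ∈ L, s i := by
  obtain ⟨i₀, hi₀, hmin⟩ := L.exists_min_image s (Finset.card_pos.1 (by omega))
  obtain ⟨i, hi, hil⟩ := hl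
  have h1 := hmin i hi
  set q := min l (k / 2) with hq
  have hcard := Finset.card_erase_of_mem hi₀
  rw [← Finset.sum_erase_add _ _ hi₀]
  rcases le_or_gt (s i₀) q with h | h
  · have h2 : (L.erase i₀).card • (k - s i₀) ≤ ∑ x ∈ L.erase i₀, s x := by
      refine Finset.card_nsmul_le_sum _ _ _ fun j hj => ?_
      have := hs i₀ hi₀ j (Finset.mem_of_mem_erase hj) (Finset.ne_of_mem_erase hj).symm
      omega
    rw [hcard, smul_eq_mul] at h2
    obtain ⟨e, he⟩ := Nat.exists_eq_add_of_le h
    have h3 : k - s i₀ = (k - q) + e := by omega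
    rw [h3, mul_add] at h2
    have h4 : e ≤ (L.card - 1) * e := Nat.le_mul_of_pos_left _ (by omega)
    omega
  · have h2 : (L.erase i₀).card • (k - q) ≤ ∑ x ∈ L.erase i₀, s x := by
      refine Finset.card_nsmul_le_sum _ _ _ fun j hj => ?_
      have := hmin j (Finset.mem_of_mem_erase hj)
      omega
    rw [hcard, smul_eq_mul] at h2
    omega

/-- The neighbors of `w` on two legs are told apart only by vertices of these legs. Hence a
generator has at least `I_k(w)` elements on the legs of `w`. -/
theorem I_le_card_inter_legs (hT : T.IsTree) {k : ℕ} {S : Finset V} (hS : IsGenerator T k S)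
    {w : V} (hw : w ∈ extMajor T) :
    I T k w ≤ (S ∩ (legs T w).biUnion (branch T w)).card := by
  obtain ⟨hwM, hcard⟩ := (mem_extMajor_iff hT).1 hw
  have hdisj : ((legs T w : Finset V) : Set V).PairwiseDisjoint (fun n => S ∩ branch T w n) :=
    fun n hn n' hn' hne => ((pairwiseDisjoint_branch hT w) (Finset.filter_subset _ _ hn)
      (Finset.filter_subset _ _ hn') hne).mono Finset.inter_subset_right Finset.inter_subset_right
  rw [Finset.inter_biUnion, Finset.card_biUnion hdisj, I_eq, ter_eq_card_legs hT hwM]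
  obtain ⟨⟨n₀, hn₀, hell⟩, -⟩ := ell_eq_card_branch hT hwM (Finset.card_pos.1 (by omega))
  refine le_sum_of_pairwise hcard
    ⟨n₀, hn₀, hell ▸ Finset.card_le_card Finset.inter_subset_right⟩ fun n hn n' hn' hne => ?_
  refine (hS n n' hne).trans ((Finset.card_le_card ?_).trans (Finset.card_union_le _ _))
  intro z hz
  obtain ⟨hzS, hz⟩ := Finset.mem_filter.1 hz
  have h1 := hT.dist_eq_dist_add_one_of_adj z (mem_legs.1 hn).1
  have h2 := hT.dist_eq_dist_add_one_of_adj z (mem_legs.1 hn').1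
  simp only [Finset.mem_union, Finset.mem_inter, hzS, true_and, mem_branch]
  rw [T.dist_comm, T.dist_comm (u := n')] at hz
  omega

theorem sum_I_le_card (hT : T.IsTree) {k : ℕ} {S : Finset V} (hS : IsGenerator T k S) :
    ∑ w ∈ extMajor T, I T k w ≤ S.card := by
  calc ∑ w ∈ extMajor T, I T k w
      ≤ ∑ w ∈ extMajor T, (S ∩ (legs T w).biUnion (branch T w)).card :=
        Finset.sum_le_sum fun w hw => I_le_card_inter_legs hT hS hw
    _ = ((extMajor T).biUnion fun w => S ∩ (legs T w).biUnion (branch T w)).card := by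
        refine (Finset.card_biUnion fun w hw w' hw' hne => ?_).symm
        refine Disjoint.mono Finset.inter_subset_right Finset.inter_subset_right ?_
        simp only [Finset.disjoint_biUnion_left, Finset.disjoint_biUnion_right]
        intro n' hn' n hn
        rw [mem_legs] at hn hn'
        exact disjoint_branch_of_notMem hT hne hn.1 hn'.1
          (fun h => hn.2 _ h ((mem_extMajor_iff hT).1 hw').1)
          (fun h => hn'.2 _ h ((mem_extMajor_iff hT).1 hw).1)
    _ ≤ S.card := Finset.card_le_card
        (Finset.biUnion_subset.2 fun w _ => Finset.inter_subset_left)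

/-- On the legs of `w` one can choose `I_k(w)` vertices so that any two legs together contain at
least `k` of them: `min l(w) ⌊k/2⌋` on a shortest leg and the difference to `k` on the others. -/
theorem exists_subset_legs (hT : T.IsTree) {k : ℕ} (hk : k ≤ varsigma T) {w : V}
    (hw : w ∈ extMajor T) :
    ∃ S : Finset V, S.card ≤ I T k w ∧ ∀ n ∈ legs T w, ∀ n' ∈ legs T w, n ≠ n' →
      k ≤ (S ∩ (branch T w n ∪ branch T w n')).card := by
  obtain ⟨hwM, hcard⟩ := (mem_extMajor_iff hT).1 hw
  obtain ⟨⟨n₀, hn₀, hell⟩, hle⟩ := ell_eq_card_branch hT hwM (Finset.card_pos.1 (by omega))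
  rw [I_eq, ter_eq_card_legs hT hwM]
  set q := min (ell T w) (k / 2) with hq
  -- the number of vertices to be chosen on each leg
  let size : V → ℕ := fun n => if n = n₀ then q else k - q
  have hsize : ∀ n, ∃ A : Finset V, n ∈ legs T w → A ⊆ branch T w n ∧ A.card = size n := by
    intro n
    by_cases hn : n ∈ legs T w
    swap
    · exact ⟨∅, fun h => absurd h hn⟩
    have : size n ≤ (branch T w n).card := by
      by_cases hnn : n = n₀
      · subst hnn
        simp only [size, if_true]
        omega
      · have h1 := hk.trans (varsigma_le_card_add_card hT hw hn hn₀ hnn)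
        have h2 := hle n hn
        simp only [size, if_neg hnn]
        omega
    obtain ⟨A, hA⟩ := Finset.exists_subset_card_eq this
    exact ⟨A, fun _ => hA⟩
  choose A hA using hsize
  refine ⟨(legs T w).biUnion A, Finset.card_biUnion_le.trans ?_, ?_⟩
  · rw [Finset.sum_congr rfl fun n hn => (hA n hn).2, ← Finset.sum_erase_add _ _ hn₀,
      Finset.sum_congr rfl fun n hn => (if_neg (Finset.ne_of_mem_erase hn) : size n = k - q),
      Finset.sum_const, Finset.card_erase_of_mem hn₀, smul_eq_mul]
    simp
  · intro n hn n' hn' hne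
    have hsub : A n ∪ A n' ⊆ (legs T w).biUnion A ∩ (branch T w n ∪ branch T w n') :=
      Finset.subset_inter
        (Finset.union_subset (Finset.subset_biUnion_of_mem A hn)
          (Finset.subset_biUnion_of_mem A hn'))
        (Finset.union_subset_union (hA n hn).1 (hA n' hn').1)
    have hdisj : Disjoint (A n) (A n') :=
      (pairwiseDisjoint_branch hT w (Finset.filter_subset _ _ hn)
        (Finset.filter_subset _ _ hn') hne).mono (hA n hn).1 (hA n' hn').1
    refine le_trans ?_ (Finset.card_le_card hsub)
    rw [Finset.card_union_of_disjoint hdisj, (hA n hn).2, (hA n' hn').2]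
    simp only [size]
    split_ifs with h1 h2
    · exact absurd (h1.trans h2.symm) hne
    all_goals omega

/-- In a branch at the midpoint `m` of `x` and `y` that contains `x`, every vertex is closer to `x`
than to `y`. -/
theorem dist_lt_dist_of_mem_branch (hT : T.IsTree) {m n x y z : V} (h : T.Adj m n)
    (hxy : T.dist x m = T.dist y m) (hx : x ∈ branch T m n) (hy : y ∉ branch T m n)
    (hz : z ∈ branch T m n) : T.dist x z < T.dist y z := by
  have h1 := dist_eq_of_mem_of_notMem_branch hT h hz hy
  have h2 := hT.connected.dist_triangle (u := x) (v := n) (w := z)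
  rw [mem_branch] at hx hz
  rw [T.dist_comm (u := z) (v := y), T.dist_comm (u := m)] at h1
  rw [T.dist_comm (u := n)] at h2
  omega

/-- Any two different vertices are told apart by all vertices of two legs of some member of
`M(T)`. -/
theorem exists_two_legs_distinguish (hT : T.IsTree) {r : V} (hr : IsMajor T r) {x y : V}
    (hxy : x ≠ y) : ∃ w ∈ extMajor T, ∃ c ∈ legs T w, ∃ c' ∈ legs T w, c ≠ c' ∧
      ∀ z ∈ branch T w c ∪ branch T w c', T.dist x z ≠ T.dist y z := by
  rcases Nat.even_or_odd' (T.dist x y) with ⟨j, hj | hj⟩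
  · obtain ⟨m, hxm, hym⟩ := exists_midpoint hT hj
    have hpos := hT.connected.pos_dist_of_ne hxy
    have hne : ∀ {a}, T.dist a m = j → a ≠ m := by
      rintro a ha rfl
      simp at ha
      omega
    obtain ⟨n, hn, hxn⟩ := exists_mem_branch hT (hne hxm)
    obtain ⟨n', hn', hyn'⟩ := exists_mem_branch hT (hne hym)
    have hnn : n ≠ n' := by
      rintro rfl
      have := hT.connected.dist_triangle (u := x) (v := n) (w := y)
      rw [mem_branch] at hxn hyn'
      rw [T.dist_comm (u := n)] at this
      omega
    have hdist : ∀ z ∈ branch T m n ∪ branch T m n', T.dist x z ≠ T.dist y z := by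
      intro z hz
      rcases Finset.mem_union.1 hz with hz | hz
      · exact (dist_lt_dist_of_mem_branch hT hn (hxm.trans hym.symm) hxn
          (fun h => hnn (eq_of_mem_branch hT hn hn' h hyn')) hz).ne
      · exact (dist_lt_dist_of_mem_branch hT hn' (hym.trans hxm.symm) hyn'
          (fun h => hnn (eq_of_mem_branch hT hn hn' hxn h)) hz).ne'
    by_cases h1 : ∃ z ∈ branch T m n, IsMajor T z
    · obtain ⟨z, hz, hzM⟩ := h1
      obtain ⟨w, hw, c, hc, c', hc', hcc, hsub⟩ := exists_extMajor_two_legs hT hn hz hzM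
      exact ⟨w, hw, c, hc, c', hc', hcc, fun z hz =>
        hdist z (Finset.mem_union_left _ (hsub hz))⟩
    by_cases h2 : ∃ z ∈ branch T m n', IsMajor T z
    · obtain ⟨z, hz, hzM⟩ := h2
      obtain ⟨w, hw, c, hc, c', hc', hcc, hsub⟩ := exists_extMajor_two_legs hT hn' hz hzM
      exact ⟨w, hw, c, hc, c', hc', hcc, fun z hz =>
        hdist z (Finset.mem_union_right _ (hsub hz))⟩
    push Not at h1 h2
    have hnl : n ∈ legs T m := mem_legs.2 ⟨hn, h1⟩
    have hnl' : n' ∈ legs T m := mem_legs.2 ⟨hn', h2⟩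
    by_cases hm : IsMajor T m
    · exact ⟨m, (mem_extMajor_iff hT).2 ⟨hm, Finset.one_lt_card.2 ⟨n, hnl, n', hnl', hnn⟩⟩,
        n, hnl, n', hnl', hnn, hdist⟩
    -- otherwise `m` has degree two and the tree consists of `m` and the two branches
    exfalso
    have hmem : n' ∈ (T.neighborFinset m).erase n := by simp [hnn.symm, hn']
    rcases (mem_branch_or hT hn r) with h | h
    · exact h1 r h hr
    rcases branch_of_not_isMajor hT hn.symm hm with ⟨-, hb⟩ | ⟨c, -, -, -, hc, hb⟩
    · rw [hb, Finset.mem_singleton] at h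
      exact hm (h ▸ hr)
    · rw [hc, Finset.mem_singleton] at hmem
      rw [hb, Finset.mem_insert, ← hmem] at h
      rcases h with rfl | h
      · exact hm hr
      · exact h2 r h hr
  · have hpos : 0 < T.degree r := by
      unfold IsMajor at hr
      omega
    obtain ⟨m, hm⟩ := (T.degree_pos_iff_exists_adj r).1 hpos
    obtain ⟨w, hw, c, hc, c', hc', hcc, -⟩ :=
      exists_extMajor_two_legs hT hm.symm (self_mem_branch hm.symm) hr
    refine ⟨w, hw, c, hc, c', hc', hcc, fun z _ he => ?_⟩
    have := dist_add_dist_parity hT x y z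
    rw [T.dist_comm, T.dist_comm (u := z) (v := y)] at this
    omega

theorem exists_isGenerator_card_le (hT : T.IsTree) {r : V} (hr : IsMajor T r) {k : ℕ}
    (hk : k ≤ varsigma T) :
    ∃ S : Finset V, IsGenerator T k S ∧ S.card ≤ ∑ w ∈ extMajor T, I T k w := by
  have hex : ∀ w, ∃ S : Finset V, w ∈ extMajor T → S.card ≤ I T k w ∧
      ∀ n ∈ legs T w, ∀ n' ∈ legs T w, n ≠ n' →
        k ≤ (S ∩ (branch T w n ∪ branch T w n')).card := by
    intro w
    by_cases hw : w ∈ extMajor T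
    · obtain ⟨S, hS⟩ := exists_subset_legs hT hk hw
      exact ⟨S, fun _ => hS⟩
    · exact ⟨∅, fun h => absurd h hw⟩
  choose S hS using hex
  refine ⟨(extMajor T).biUnion S, fun x y hxy => ?_,
    Finset.card_biUnion_le.trans (Finset.sum_le_sum fun w hw => (hS w hw).1)⟩
  obtain ⟨w, hw, c, hc, c', hc', hcc, hd⟩ := exists_two_legs_distinguish hT hr hxy
  refine ((hS w hw).2 c hc c' hc' hcc).trans (Finset.card_le_card fun z hz => ?_)
  rw [Finset.mem_inter] at hz
  exact Finset.mem_filter.2 ⟨Finset.mem_biUnion.2 ⟨w, hw, hz.1⟩, hd z hz.2⟩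

theorem dim_eq_sum_I (hT : T.IsTree) {r : V} (hr : IsMajor T r) {k : ℕ} (hk : k ≤ varsigma T) :
    dim T k = ((∑ w ∈ extMajor T, I T k w : ℕ) : ℕ∞) := by
  refine le_antisymm ?_ (le_iInf₂ fun S hS => by exact_mod_cast sum_I_le_card hT hS)
  obtain ⟨S, hS, hcard⟩ := exists_isGenerator_card_le hT hr hk
  exact (iInf₂_le S hS).trans (by exact_mod_cast hcard)

/-! ### The labels -/

/-- The sum of `I_k(w)` over the members `w` of `M(T)` in the branch at `m` towards `n`. -/
noncomputable def branchSum (T : SimpleGraph V) (k : ℕ) (m n : V) : ℕ :=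
  ∑ w ∈ branch T m n, if w ∈ extMajor T then I T k w else 0

theorem branchSum_eq_zero (hT : T.IsTree) {k : ℕ} {m n : V}
    (h : ∀ z ∈ branch T m n, ¬ IsMajor T z) : branchSum T k m n = 0 :=
  Finset.sum_eq_zero fun w hw => if_neg fun hw' => h w hw ((mem_extMajor_iff hT).1 hw').1

theorem branchSum_eq_add_sum (hT : T.IsTree) (k : ℕ) {m n : V} (h : T.Adj m n) :
    branchSum T k m n = (if n ∈ extMajor T then I T k n else 0) +
      ∑ c ∈ (T.neighborFinset n).erase m, branchSum T k n c := by
  rw [branchSum, branch_eq_insert_biUnion hT h, Finset.sum_insert, Finset.sum_biUnion]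
  · rfl
  · exact (pairwiseDisjoint_branch hT n).subset (by simp)
  · simp [notMem_branch_self]

theorem sum_I_eq_add_sum_branchSum (hT : T.IsTree) (k : ℕ) (r : V) :
    ∑ w ∈ extMajor T, I T k w = (if r ∈ extMajor T then I T k r else 0) +
      ∑ c ∈ T.neighborFinset r, branchSum T k r c := by
  have huniv : (Finset.univ : Finset V) =
      insert r ((T.neighborFinset r).biUnion (branch T r)) := by
    ext z
    simp only [Finset.mem_univ, Finset.mem_insert, Finset.mem_biUnion,
      SimpleGraph.mem_neighborFinset, true_iff]
    exact or_iff_not_imp_left.2 fun hz => exists_mem_branch hT hz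
  have hsum : ∑ w ∈ extMajor T, I T k w =
      ∑ w : V, if w ∈ extMajor T then I T k w else 0 := by
    rw [Finset.sum_ite_mem, Finset.univ_inter]
  rw [hsum, huniv, Finset.sum_insert, Finset.sum_biUnion (pairwiseDisjoint_branch hT r)]
  · rfl
  · simp [notMem_branch_self]

theorem children_of_mem_branch (hT : T.IsTree) {r p u : V} (h : T.Adj p u)
    (hr : r ∈ branch T u p) : children T r u = (T.neighborFinset u).erase p := by
  ext c
  simp only [children, Finset.mem_filter, Finset.mem_univ, true_and, Finset.mem_erase,
    SimpleGraph.mem_neighborFinset]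
  constructor
  · rintro ⟨hc, hd⟩
    refine ⟨?_, hc⟩
    rintro rfl
    rw [mem_branch] at hr
    omega
  · rintro ⟨hcp, hc⟩
    refine ⟨hc, (hT.dist_eq_dist_add_one_of_adj r hc).resolve_left fun hd => hcp ?_⟩
    exact eq_of_mem_branch hT hc h.symm (mem_branch.2 hd) hr

theorem children_root (T : SimpleGraph V) (r : V) : children T r r = T.neighborFinset r := by
  ext c
  simp only [children, Finset.mem_filter, Finset.mem_univ, true_and,
    SimpleGraph.mem_neighborFinset, T.dist_self, zero_add, SimpleGraph.dist_eq_one_iff_adj,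
    and_self]

/-- The label that a vertex `u` should get from the branch of its parent `p` that starts with
`u`. -/
noncomputable def branchLabel (T : SimpleGraph V) (k : ℕ) (p u : V) : ℕ∞ × ℕ∞ :=
  if ∀ z ∈ branch T p u, ¬ IsMajor T z then ((branch T p u).card, ⊤)
  else (⊤, branchSum T k p u)

theorem branchLabel_of_forall {k : ℕ} {p u : V} (h : ∀ z ∈ branch T p u, ¬ IsMajor T z) :
    branchLabel T k p u = (((branch T p u).card : ℕ∞), ⊤) := if_pos h

theorem branchLabel_of_not_forall {k : ℕ} {p u : V}
    (h : ¬ ∀ z ∈ branch T p u, ¬ IsMajor T z) :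
    branchLabel T k p u = (⊤, (branchSum T k p u : ℕ∞)) := if_neg h

theorem inf_branchLabel_eq_ell (hT : T.IsTree) {k : ℕ} {u : V} {C : Finset V} (hu : IsMajor T u)
    (hC : C ⊆ T.neighborFinset u) (hlegs : legs T u ⊆ C) (hne : (legs T u).Nonempty) :
    C.inf (fun c => (branchLabel T k u c).1) = (ell T u : ℕ∞) := by
  obtain ⟨⟨n, hn, hell⟩, hle⟩ := ell_eq_card_branch hT hu hne
  refine le_antisymm ((Finset.inf_le (hlegs hn)).trans ?_) (Finset.le_inf fun c hc => ?_)
  · rw [branchLabel_of_forall (mem_legs.1 hn).2, hell]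
  · by_cases h : ∀ z ∈ branch T u c, ¬ IsMajor T z
    · rw [branchLabel_of_forall h]
      exact Nat.cast_le.2 (hle c (mem_legs.2 ⟨by simpa using hC hc, h⟩))
    · rw [branchLabel_of_not_forall h]
      exact le_top

/-- At a major vertex `u` the algorithm finds the legs of `u` as the children with a finite first
label, so that it adds `I_k(u)` exactly when `u` is in `M(T)`. -/
theorem step_branchLabel (hT : T.IsTree) {k : ℕ} {u : V} {C : Finset V} (hu : IsMajor T u)
    (hC : C ⊆ T.neighborFinset u) (hlegs : legs T u ⊆ C) (hcard : 2 ≤ C.card) :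
    step k (C.val.map (branchLabel T k u)) =
      (⊤, (((if u ∈ extMajor T then I T k u else 0) + ∑ c ∈ C, branchSum T k u c : ℕ) : ℕ∞)) := by
  have hc : ((C.val.map (branchLabel T k u)).filter fun p => p.1 ≠ ⊤).card =
      (legs T u).card := by
    rw [Multiset.filter_map, Multiset.card_map, ← Finset.filter_val, Finset.card_val]
    congr 1
    ext c
    simp only [Finset.mem_filter, Function.comp_apply, mem_legs]
    constructor
    · rintro ⟨hc, h⟩
      refine ⟨by simpa using hC hc, ?_⟩
      by_contra hcon
      exact h (by rw [branchLabel_of_not_forall hcon])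
    · rintro ⟨ha, h⟩
      exact ⟨hlegs (mem_legs.2 ⟨ha, h⟩), by simp [branchLabel_of_forall h]⟩
  have hs : (((C.val.map (branchLabel T k u)).map Prod.snd).filter fun b => b ≠ ⊤).sum =
      ((∑ c ∈ C, branchSum T k u c : ℕ) : ℕ∞) := by
    rw [Multiset.map_map, Multiset.filter_map, ← Finset.filter_val, ← Finset.sum_eq_multiset_sum,
      Finset.sum_filter, Nat.cast_sum]
    refine Finset.sum_congr rfl fun c _ => ?_
    by_cases h : ∀ z ∈ branch T u c, ¬ IsMajor T z
    · simp [branchLabel_of_forall h, branchSum_eq_zero hT h]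
    · simp [branchLabel_of_not_forall h]
  have ha : (legs T u).Nonempty →
      ((C.val.map (branchLabel T k u)).map Prod.fst).inf = (ell T u : ℕ∞) := by
    intro hne
    rw [← inf_branchLabel_eq_ell hT hu hC hlegs hne, Multiset.map_map]
    rfl
  unfold step
  rw [Multiset.card_map, Finset.card_val, if_neg (by omega), if_neg (by omega)]
  simp only [hc, hs]
  congr 1
  by_cases h2 : (legs T u).card ≤ 1
  · rw [if_pos h2, if_neg fun h => by have := ((mem_extMajor_iff hT).1 h).2; omega, zero_add]
  · rw [if_neg h2, if_pos ((mem_extMajor_iff hT).2 ⟨hu, by omega⟩),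
      ha (Finset.card_pos.1 (by omega)), I, ter_eq_card_legs hT hu]
    simp only [Nat.cast_le]
    split_ifs with h
    · push_cast
      ring
    · push_cast
      ring

theorem label_eq_branchLabel (hT : T.IsTree) {r : V} (hr : IsMajor T r) (k : ℕ) {p u : V}
    (h : T.Adj p u) (hru : r ∈ branch T u p) : label T r k u = branchLabel T k p u := by
  induction hd : (branch T p u).card using Nat.strong_induction_on generalizing p u with
  | _ d ih =>
  have hchild : ∀ c ∈ (T.neighborFinset u).erase p, label T r k c = branchLabel T k u c := by
    intro c hc
    rw [Finset.mem_erase, SimpleGraph.mem_neighborFinset] at hc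
    refine ih _ (hd ▸ card_branch_lt hT h hc.2 hc.1) hc.2 ?_ rfl
    exact (mem_branch_or hT hc.2 r).resolve_left fun hrc =>
      hc.1 (eq_of_mem_branch hT hc.2 h.symm hrc hru)
  rw [label_eq, children_of_mem_branch hT h hru, Multiset.map_congr rfl hchild]
  by_cases hu : IsMajor T u
  · have hlegs : legs T u ⊆ (T.neighborFinset u).erase p := by
      intro c hc
      rw [mem_legs] at hc
      rw [Finset.mem_erase, SimpleGraph.mem_neighborFinset]
      refine ⟨?_, hc.1⟩
      rintro rfl
      exact hc.2 r hru hr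
    have hcard : 2 ≤ ((T.neighborFinset u).erase p).card := by
      have hp : p ∈ T.neighborFinset u := by simpa using h.symm
      have := Finset.card_erase_add_one hp
      rw [SimpleGraph.card_neighborFinset_eq_degree] at this
      unfold IsMajor at hu
      omega
    rw [step_branchLabel hT hu (Finset.erase_subset _ _) hlegs hcard,
      branchLabel_of_not_forall fun hall => hall u (self_mem_branch h) hu,
      branchSum_eq_add_sum hT k h]
  · rcases branch_of_not_isMajor hT h hu with ⟨h1, hb⟩ | ⟨c, hc, hcp, -, her, hb⟩
    · have hp : p ∈ T.neighborFinset u := by simpa using h.symm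
      have h0 := Finset.card_erase_add_one hp
      rw [SimpleGraph.card_neighborFinset_eq_degree, h1] at h0
      rw [Finset.card_eq_zero.1 (show ((T.neighborFinset u).erase p).card = 0 by omega),
        branchLabel_of_forall (p := p) (u := u) (by simpa [hb] using hu), hb]
      simp [step]
    · have hnot : u ∉ extMajor T := fun hmem => hu ((mem_extMajor_iff hT).1 hmem).1
      have hS : branchSum T k p u = branchSum T k u c := by
        rw [branchSum_eq_add_sum hT k h, her, if_neg hnot, Finset.sum_singleton, zero_add]
      have hiff : (∀ z ∈ branch T p u, ¬ IsMajor T z) ↔ ∀ z ∈ branch T u c, ¬ IsMajor T z := by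
        simp [hb, hu]
      have hcard : (branch T p u).card = (branch T u c).card + 1 := by
        rw [hb, Finset.card_insert_of_notMem notMem_branch_self]
      rw [her]
      by_cases hfree : ∀ z ∈ branch T u c, ¬ IsMajor T z
      · rw [branchLabel_of_forall (hiff.2 hfree), hcard]
        simp [step, branchLabel_of_forall hfree]
      · rw [branchLabel_of_not_forall (mt hiff.1 hfree), hS]
        simp [step, branchLabel_of_not_forall hfree]

theorem output_eq_sum_I (hT : T.IsTree) {r : V} (hr : IsMajor T r) (k : ℕ) :
    output T r k = ((∑ w ∈ extMajor T, I T k w : ℕ) : ℕ∞) := by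
  have hchild : ∀ c ∈ T.neighborFinset r, label T r k c = branchLabel T k r c := by
    intro c hc
    rw [SimpleGraph.mem_neighborFinset] at hc
    exact label_eq_branchLabel hT hr k hc (self_mem_branch hc.symm)
  rw [output, label_eq, children_root, Multiset.map_congr rfl hchild,
    step_branchLabel hT hr subset_rfl (Finset.filter_subset _ _), sum_I_eq_add_sum_branchSum hT k r]
  rw [SimpleGraph.card_neighborFinset_eq_degree]
  unfold IsMajor at hr
  omega

end Tree

end KMetric

theorem mainTheorem7 {V : Type*} [Fintype V] (T : SimpleGraph V) (hT : T.IsTree)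
    (hpath : ¬ KMetric.IsPathGraph T) (k : ℕ) (hk : k ≤ KMetric.varsigma T) :
    (∃ r : V, KMetric.IsMajor T r) ∧
    (∀ r : V, KMetric.IsMajor T r →
      KMetric.output T r k = KMetric.dim T k ∧
      KMetric.output T r k = ((∑ w ∈ KMetric.extMajor T, KMetric.I T k w : ℕ) : ℕ∞)) := by
  refine ⟨?_, fun r hr => ?_⟩
  · by_contra hno
    exact hpath (KMetric.isPathGraph_of_forall_not_isMajor hT (not_exists.1 hno))
  · have h := KMetric.output_eq_sum_I hT hr k
    exact ⟨h.trans (KMetric.dim_eq_sum_I hT hr hk).symm, h⟩
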